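/- Conventions. A metric structure $M$ is a metric space $(M,d)$ of diameter at most $1$, together with functions $f^M : M^{k}\to M$, predicates $R^M : M^{k}\to[0,1]$ and distinguished elements $c^M\in M$, named by the symbols of a metric signature. The signature assigns to each function symbol and each predicate symbol an arity $k$ and a modulus $\delta : \mathbb{Q}\cap(0,1)\to\mathbb{Q}\cap(0,1)$, and the interpretations respect it: for all $a,b\in M^k$ and $\epsilon\in\mathbb{Q}\cap(0,1)$, $\max_i d(a_i,b_i)<\delta(\epsilon)$ implies $d(f^M(a),f^M(b))\le\epsilon$, respectively $|R^M(a)-R^M(b)|\le\epsilon$. An automorphism of $M$ is an isometric bijection $M\to M$ that preserves all these functions, predicates and distinguished elements. The formulas of $\mathcal{L}_{\omega_1,\omega}$ are built from the atomic formulas $d(t_1,t_2)$ and $R(t_1,\ldots,t_k)$, where the $t_i$ are terms, by applying continuous functions $u:[0,1]^k\to[0,1]$ (for $k<\omega$) as connectives, the quantifiers $\inf_x$ and $\sup_x$, and countable infima $\inf_{k<\omega}\phi_k$ and suprema $\sup_{k<\omega}\phi_k$, where the latter are allowed whenever the total number of free variables of the $\phi_k$ is finite (no continuity is required). The value $\phi^M(\vec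 a)\in[0,1]$ of a formula $\phi(\vec x)$ at a tuple $\vec a$ of $M$ is defined by the obvious recursion. For $A\subseteq M$, a formula with parameters from $A$ is an $\mathcal{L}_{\omega_1,\omega}$ formula in the signature enlarged by a constant symbol for each $a\in A$, interpreted in $M$ as $a$ (in particular, infinitely many parameters may occur in it). Theorem. Let $M$ be a separable complete metric structure in a countable metric signature, let $A\subseteq M$, and let $n\ge 0$. For any continuous function $P:M^n\to[0,1]$, the following are equivalent: (1) there is an $\mathcal{L}_{\omega_1,\omega}$ formula $\phi(x_1,\ldots,x_n)$ with parameters from $A$ such that $\phi^M(\vec a)=P(\vec a)$ for all $\vec a\in M^n$; (2) $P$ is fixed by all automorphisms of $M$ that fix $A$ pointwise, i.e. $P(a_1,\ldots,a_n)=P(\Phi(a_1),\ldots,\Phi(a_n))$ for every such automorphism $\Phi$ and all $\vec a\in M^n$; (3) $P$ is fixed, in the same sense, by all automorphisms of $M$ that fix the closure $\overline{A}$ pointwise. -/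

import Mathlib

universe uF uP uC uM

/-- The set `ℚ ∩ (0, 1)`. -/
abbrev UnitRat : Type := Set.Ioo (0 : ℚ) 1

/-- A metric signature: function symbols and predicate symbols, each with an arity and a modulus of
uniform continuity `ℚ ∩ (0, 1) → ℚ ∩ (0, 1)`, and constant symbols. -/
structure MetricSignature where
  Func : Type uF
  funcArity : Func → ℕ
  funcMod : Func → UnitRat → UnitRat
  Pred : Type uP
  predArity : Pred → ℕ
  predMod : Pred → UnitRat → UnitRat
  Const : Type uC

namespace MetricSignature

/-- A signature is countable if it has countably many symbols. -/
def IsCountable (S : MetricSignature.{uF, uP, uC}) : Prop :=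
  Countable S.Func ∧ Countable S.Pred ∧ Countable S.Const

/-- `S` together with a new constant symbol for each element of `A`. -/
def withConstants (S : MetricSignature.{uF, uP, uC}) {M : Type uM} (A : Set M) :
    MetricSignature.{uF, uP, max uC uM} where
  Func := S.Func
  funcArity := S.funcArity
  funcMod := S.funcMod
  Pred := S.Pred
  predArity := S.predArity
  predMod := S.predMod
  Const := S.Const ⊕ A

/-- Terms of `S` with variables among `x₀, …, xₙ₋₁`. -/
inductive Term (S : MetricSignature.{uF, uP, uC}) (n : ℕ)
  | var (i : Fin n) : Term S n
  | const (c : S.Const) : Term S n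
  | func (f : S.Func) (ts : Fin (S.funcArity f) → Term S n) : Term S n

/-- Formulas of `L_{ω₁,ω}` over `S` with free variables among `x₀, …, xₙ₋₁`. The connectives are the
continuous functions `[0,1]ᵏ → [0,1]`, the quantifiers `inf_x` and `sup_x` bind the variable `xₙ` of a
formula in `x₀, …, xₙ`, and countable infima and suprema are allowed for every sequence of formulas
in the finitely many variables `x₀, …, xₙ₋₁`, without any continuity requirement. -/
inductive Formula (S : MetricSignature.{uF, uP, uC}) : ℕ → Type _
  | dist {n : ℕ} (t₁ t₂ : Term S n) : Formula S n
  | pred {n : ℕ} (R : S.Pred) (ts : Fin (S.predArity R) → Term S n) : Formula S n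
  | conn {n k : ℕ} (u : C(Fin k → unitInterval, unitInterval)) (φ : Fin k → Formula S n) :
      Formula S n
  | infVar {n : ℕ} (φ : Formula S (n + 1)) : Formula S n
  | supVar {n : ℕ} (φ : Formula S (n + 1)) : Formula S n
  | infSeq {n : ℕ} (φ : ℕ → Formula S n) : Formula S n
  | supSeq {n : ℕ} (φ : ℕ → Formula S n) : Formula S n

end MetricSignature

/-- An `S`-structure on the metric space `M`: the diameter is at most `1`, and the symbols are
interpreted by functions, predicates and elements that respect the moduli of `S`. The distance of two
tuples is the maximum of the distances of their entries. -/
structure MetricStructure (S : MetricSignature.{uF, uP, uC}) (M : Type uM) [MetricSpace M] where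
  dist_le_one : ∀ a b : M, dist a b ≤ 1
  func : ∀ f : S.Func, (Fin (S.funcArity f) → M) → M
  func_modulus : ∀ (f : S.Func) (ε : UnitRat) (a b : Fin (S.funcArity f) → M),
    dist a b < ((S.funcMod f ε : ℚ) : ℝ) → dist (func f a) (func f b) ≤ ((ε : ℚ) : ℝ)
  pred : ∀ R : S.Pred, (Fin (S.predArity R) → M) → unitInterval
  pred_modulus : ∀ (R : S.Pred) (ε : UnitRat) (a b : Fin (S.predArity R) → M),
    dist a b < ((S.predMod R ε : ℚ) : ℝ) → |(pred R a : ℝ) - (pred R b : ℝ)| ≤ ((ε : ℚ) : ℝ)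
  const : S.Const → M

namespace MetricStructure

variable {S : MetricSignature.{uF, uP, uC}} {M : Type uM} [MetricSpace M]

/-- The expansion of a structure in which each `a ∈ A` is named by its own constant symbol. -/
def withConstants (𝓜 : MetricStructure S M) (A : Set M) :
    MetricStructure (S.withConstants A) M where
  dist_le_one := 𝓜.dist_le_one
  func := 𝓜.func
  func_modulus := 𝓜.func_modulus
  pred := 𝓜.pred
  pred_modulus := 𝓜.pred_modulus
  const := Sum.elim 𝓜.const (fun a => (a : M))

/-- The distance as a function with values in `[0, 1]`. -/
def unitDist (𝓜 : MetricStructure S M) (a b : M) : unitInterval :=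
  ⟨dist a b, dist_nonneg, 𝓜.dist_le_one a b⟩

/-- The value of a term at a tuple. -/
def termVal (𝓜 : MetricStructure S M) {n : ℕ} (v : Fin n → M) : S.Term n → M
  | .var i => v i
  | .const c => 𝓜.const c
  | .func f ts => 𝓜.func f (fun i => 𝓜.termVal v (ts i))

/-- The value `φ^M(v)` of a formula at a tuple; infima and suprema are taken in `[0, 1]`. -/
noncomputable def eval (𝓜 : MetricStructure S M) :
    {n : ℕ} → S.Formula n → (Fin n → M) → unitInterval
  | _, .dist t₁ t₂, v => 𝓜.unitDist (𝓜.termVal v t₁) (𝓜.termVal v t₂)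
  | _, .pred R ts, v => 𝓜.pred R (fun i => 𝓜.termVal v (ts i))
  | _, .conn u φ, v => u (fun i => 𝓜.eval (φ i) v)
  | n, .infVar φ, v => ⨅ a : M, 𝓜.eval φ (Fin.snoc v a : Fin (n + 1) → M)
  | n, .supVar φ, v => ⨆ a : M, 𝓜.eval φ (Fin.snoc v a : Fin (n + 1) → M)
  | _, .infSeq φ, v => ⨅ k : ℕ, 𝓜.eval (φ k) v
  | _, .supSeq φ, v => ⨆ k : ℕ, 𝓜.eval (φ k) v

/-- Automorphisms of a metric structure: isometric bijections that preserve all functions, predicates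
and distinguished elements. -/
structure Automorphism (𝓜 : MetricStructure S M) where
  toIsometryEquiv : M ≃ᵢ M
  map_func : ∀ (f : S.Func) (a : Fin (S.funcArity f) → M),
    toIsometryEquiv (𝓜.func f a) = 𝓜.func f (fun i => toIsometryEquiv (a i))
  map_pred : ∀ (R : S.Pred) (a : Fin (S.predArity R) → M),
    𝓜.pred R (fun i => toIsometryEquiv (a i)) = 𝓜.pred R a
  map_const : ∀ c : S.Const, toIsometryEquiv (𝓜.const c) = 𝓜.const c

instance (𝓜 : MetricStructure S M) : CoeFun 𝓜.Automorphism (fun _ => M → M) where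
  coe Φ := Φ.toIsometryEquiv

end MetricStructure

/-! Formulas are invariant under automorphisms by induction, and an automorphism fixing `A` fixes
its closure by continuity. The substance is to find a formula for an invariant continuous `P`;
naming the elements of `A` by constants removes the parameters.

Measure how far the types of two tuples differ by `typeDist`, the supremum of `|f a - f b|` over
definable `1`-Lipschitz `f`. By separability, countably many such `f` compute `typeDist a`, which is
therefore itself definable and `1`-Lipschitz (`definable_typeDist`). Hence infima built from it are
again admissible test functions: this extends tuples without losing closeness of types
(`exists_typeDist_snoc_lt`) and trades closeness of types for closeness of points
(`exists_dist_lt_of_typeDist_lt`). A back-and-forth with errors `r / 2 ^ k` converges to an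
automorphism taking `a` to within `2 * r` of `b` whenever `typeDist a b < r`
(`exists_automorphism_dist_le`).

So tuples whose types are close to that of `v` have `P`-values close to `P v`, and `P` is recovered
as a supremum over `N` of infima of `P d + N * typeDist d v` (truncated at `1`) over a dense
sequence of tuples `d` (`definable_of_invariant`). -/

open Filter Topology

/-! ### Metric preliminaries -/

/-- Two dense families with the same mutual distances are matched by an isometric bijection. -/
theorem exists_isometryEquiv_of_dist_eq {M ι : Type*} [MetricSpace M] [CompleteSpace M]
    {u v : ι → M} (hu : DenseRange u) (hv : DenseRange v)
    (huv : ∀ i j, dist (u i) (u j) = dist (v i) (v j)) :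
    ∃ Φ : M ≃ᵢ M, ∀ i, Φ (u i) = v i := by
  -- The closure of the matching is the graph of the isometry: preserving distances is a closed
  -- condition, and completeness makes both projections surjective.
  let G : Set (M × M) := closure (Set.range fun i => (u i, v i))
  have hG : ∀ p ∈ G, ∀ q ∈ G, dist p.1 q.1 = dist p.2 q.2 := by
    have hcl : IsClosed {z : (M × M) × (M × M) | dist z.1.1 z.2.1 = dist z.1.2 z.2.2} :=
      isClosed_eq (by fun_prop) (by fun_prop)
    intro p hp q hq
    have hpq : (p, q) ∈ closure
        ((Set.range fun i => (u i, v i)) ×ˢ (Set.range fun i => (u i, v i))) := by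
      rw [closure_prod_eq]; exact ⟨hp, hq⟩
    refine closure_minimal ?_ hcl hpq
    rintro ⟨_, _⟩ ⟨⟨i, rfl⟩, ⟨j, rfl⟩⟩
    exact huv i j
  have key : ∀ {u v : ι → M}, DenseRange u → (∀ i j, dist (u i) (u j) = dist (v i) (v j)) →
      ∀ x, ∃ y, (x, y) ∈ closure (Set.range fun i => (u i, v i)) := by
    intro u v hu huv x
    obtain ⟨s, hs, hsx⟩ := mem_closure_iff_seq_limit.1 (hu x)
    choose i hi using hs
    have hus : Tendsto (fun k => u (i k)) atTop (𝓝 x) := by simpa only [hi] using hsx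
    have hc : CauchySeq (fun k => v (i k)) := by
      have := hus.cauchySeq
      rw [Metric.cauchySeq_iff] at this ⊢
      simpa only [huv] using this
    obtain ⟨y, hy⟩ := cauchySeq_tendsto_of_complete hc
    exact ⟨y, mem_closure_of_tendsto (hus.prodMk_nhds hy)
      (Eventually.of_forall fun k => ⟨i k, rfl⟩)⟩
  choose f hf using key hu huv
  have hg : ∀ y, ∃ x, (x, y) ∈ G := by
    intro y
    obtain ⟨x, hx⟩ := key hv (fun i j => (huv i j).symm) y
    refine ⟨x, ?_⟩
    have := image_closure_subset_closure_image continuous_swap ⟨_, hx, rfl⟩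
    rw [← Set.range_comp] at this
    exact this
  choose g hg using hg
  have hfu : ∀ x y, (x, y) ∈ G → f x = y := fun x y h => by
    have := hG _ (hf x) _ h
    simpa using this.symm
  refine ⟨IsometryEquiv.mk' f g (fun y => hfu _ _ (hg y))
    (Isometry.of_dist_eq fun x y => (hG _ (hf x) _ (hf y)).symm), fun i => ?_⟩
  exact hfu _ _ (subset_closure ⟨i, rfl⟩)

theorem LipschitzWith.le_add_dist {X : Type*} [PseudoMetricSpace X] {f : X → ℝ}
    (hf : LipschitzWith 1 f) (x y : X) : f x ≤ f y + dist x y := by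
  have := hf.dist_le_mul x y
  rw [Real.dist_eq, NNReal.coe_one, one_mul] at this
  linarith [le_abs_self (f x - f y)]

theorem LipschitzWith.ciInf {X ι : Type*} [PseudoMetricSpace X] [Nonempty ι] {f : ι → X → ℝ}
    (hb : ∀ x, BddBelow (Set.range fun i => f i x)) (hf : ∀ i, LipschitzWith 1 (f i)) :
    LipschitzWith 1 fun x => ⨅ i, f i x := by
  refine LipschitzWith.of_le_add fun x y => ?_
  rw [← sub_le_iff_le_add]
  refine le_ciInf fun i => ?_
  rw [sub_le_iff_le_add]
  exact (ciInf_le (hb x) i).trans ((hf i).le_add_dist x y)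

theorem LipschitzWith.ciSup {X ι : Type*} [PseudoMetricSpace X] [Nonempty ι] {f : ι → X → ℝ}
    (hb : ∀ x, BddAbove (Set.range fun i => f i x)) (hf : ∀ i, LipschitzWith 1 (f i)) :
    LipschitzWith 1 fun x => ⨆ i, f i x := by
  refine LipschitzWith.of_le_add fun x y => ciSup_le fun i => ?_
  have := le_ciSup (hb y) i
  linarith [(hf i).le_add_dist x y]

theorem Fin.dist_snoc {M : Type*} [PseudoMetricSpace M] {n : ℕ} (x y : Fin n → M) (a b : M) :
    dist (Fin.snoc x a : Fin (n + 1) → M) (Fin.snoc y b) = max (dist x y) (dist a b) := by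
  refine le_antisymm ((dist_pi_le_iff (by positivity)).2 fun i => ?_) (max_le
    ((dist_pi_le_iff dist_nonneg).2 fun i => ?_) ?_)
  · refine Fin.lastCases ?_ (fun i => ?_) i
    · simp
    · simpa using Or.inl (dist_le_pi_dist x y i)
  · simpa using dist_le_pi_dist (Fin.snoc x a : Fin (n + 1) → M) (Fin.snoc y b) i.castSucc
  · simpa using dist_le_pi_dist (Fin.snoc x a : Fin (n + 1) → M) (Fin.snoc y b) (Fin.last n)

/-! ### Renaming of variables and invariance under automorphisms -/

namespace MetricSignature

/-- Renaming of variables in a term. -/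
def Term.rename {S : MetricSignature.{uF, uP, uC}} {n m : ℕ} (σ : Fin n → Fin m) :
    S.Term n → S.Term m
  | .var i => .var (σ i)
  | .const c => .const c
  | .func f ts => .func f fun i => (ts i).rename σ

end MetricSignature

namespace MetricStructure

variable {S : MetricSignature.{uF, uP, uC}} {M : Type uM} [MetricSpace M]

theorem termVal_rename (𝓜 : MetricStructure S M) {n m : ℕ} (σ : Fin n → Fin m) (v : Fin m → M)
    (t : S.Term n) : 𝓜.termVal v (t.rename σ) = 𝓜.termVal (v ∘ σ) t := by
  induction t with
  | var i => rfl
  | const c => rfl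
  | func f ts ih => simp only [MetricSignature.Term.rename, termVal, ih]

theorem exists_eval_comp (𝓜 : MetricStructure S M) {n : ℕ} (φ : S.Formula n) :
    ∀ {m : ℕ} (σ : Fin n → Fin m), ∃ ψ : S.Formula m, ∀ v, 𝓜.eval ψ v = 𝓜.eval φ (v ∘ σ) := by
  have hsnoc : ∀ {n m : ℕ} (σ : Fin n → Fin m) (v : Fin m → M) (a : M),
      (Fin.snoc v a : Fin (m + 1) → M) ∘ (Fin.snoc (Fin.castSucc ∘ σ) (Fin.last m) :
        Fin (n + 1) → Fin (m + 1)) = Fin.snoc (v ∘ σ) a := by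
    intro n m σ v a
    funext i
    refine Fin.lastCases ?_ (fun i => ?_) i <;> simp
  induction φ with
  | dist t₁ t₂ =>
    exact fun σ => ⟨.dist (t₁.rename σ) (t₂.rename σ), fun v => by
      simp only [eval, termVal_rename]⟩
  | pred R ts =>
    exact fun σ => ⟨.pred R fun i => (ts i).rename σ, fun v => by
      simp only [eval, termVal_rename]⟩
  | conn u φ ih =>
    intro m σ
    choose ψ hψ using fun i => ih i σ
    exact ⟨.conn u ψ, fun v => by simp only [eval, hψ]⟩
  | infVar φ ih =>
    intro m σ
    obtain ⟨ψ, hψ⟩ := ih (Fin.snoc (Fin.castSucc ∘ σ) (Fin.last m))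
    exact ⟨.infVar ψ, fun v => by simp only [eval, hψ, hsnoc]⟩
  | supVar φ ih =>
    intro m σ
    obtain ⟨ψ, hψ⟩ := ih (Fin.snoc (Fin.castSucc ∘ σ) (Fin.last m))
    exact ⟨.supVar ψ, fun v => by simp only [eval, hψ, hsnoc]⟩
  | infSeq φ ih =>
    intro m σ
    choose ψ hψ using fun i => ih i σ
    exact ⟨.infSeq ψ, fun v => by simp only [eval, hψ]⟩
  | supSeq φ ih =>
    intro m σ
    choose ψ hψ using fun i => ih i σ
    exact ⟨.supSeq ψ, fun v => by simp only [eval, hψ]⟩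

/-- Automorphisms commute with the interpretation of terms. -/
theorem Automorphism.map_termVal {𝓜 : MetricStructure S M} (Φ : 𝓜.Automorphism) {n : ℕ}
    (v : Fin n → M) (t : S.Term n) :
    𝓜.termVal (fun i => Φ (v i)) t = Φ (𝓜.termVal v t) := by
  induction t with
  | var i => rfl
  | const c => exact (Φ.map_const c).symm
  | func f ts ih => simp only [termVal, ih, Φ.map_func]

/-- The values of formulas are invariant under automorphisms. -/
theorem Automorphism.eval_map {𝓜 : MetricStructure S M} (Φ : 𝓜.Automorphism) {n : ℕ}
    (φ : S.Formula n) : ∀ v : Fin n → M, 𝓜.eval φ (fun i => Φ (v i)) = 𝓜.eval φ v := by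
  have hsnoc : ∀ {n : ℕ} (v : Fin n → M) (a : M),
      (Fin.snoc (fun i => Φ (v i)) (Φ a) : Fin (n + 1) → M) =
        fun i => Φ ((Fin.snoc v a : Fin (n + 1) → M) i) := by
    intro n v a
    funext i
    refine Fin.lastCases ?_ (fun i => ?_) i <;> simp
  induction φ with
  | dist t₁ t₂ =>
    intro v
    simp only [eval, unitDist, Φ.map_termVal, Φ.toIsometryEquiv.dist_eq]
  | pred R ts => intro v; simp only [eval, Φ.map_termVal, Φ.map_pred]
  | conn u φ ih => intro v; simp only [eval, ih]
  | infVar φ ih =>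
    intro v
    simp only [eval]
    rw [← Φ.toIsometryEquiv.surjective.iInf_comp]
    simp only [hsnoc, ih]
  | supVar φ ih =>
    intro v
    simp only [eval]
    rw [← Φ.toIsometryEquiv.surjective.iSup_comp]
    simp only [hsnoc, ih]
  | infSeq φ ih => intro v; simp only [eval, ih]
  | supSeq φ ih => intro v; simp only [eval, ih]

/-! ### Closure properties of definable functions -/

/-- A real-valued function is definable if it is the value of an `L_{ω₁,ω}` formula. -/
def Definable (𝓜 : MetricStructure S M) {n : ℕ} (f : (Fin n → M) → ℝ) : Prop :=
  ∃ φ : S.Formula n, ∀ v, (𝓜.eval φ v : ℝ) = f v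

namespace Definable

variable {𝓜 : MetricStructure S M} {n : ℕ}

theorem nonneg {f : (Fin n → M) → ℝ} (hf : 𝓜.Definable f) (v : Fin n → M) : 0 ≤ f v := by
  obtain ⟨φ, hφ⟩ := hf
  exact hφ v ▸ (𝓜.eval φ v).2.1

theorem le_one {f : (Fin n → M) → ℝ} (hf : 𝓜.Definable f) (v : Fin n → M) : f v ≤ 1 := by
  obtain ⟨φ, hφ⟩ := hf
  exact hφ v ▸ (𝓜.eval φ v).2.2

/-- Clamping `u` to `[0, 1]` makes it a legitimate connective, and changes nothing at the values
actually attained. -/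
theorem comp {k : ℕ} {f : Fin k → (Fin n → M) → ℝ} (hf : ∀ i, 𝓜.Definable (f i))
    {u : (Fin k → ℝ) → ℝ} (hu : Continuous u)
    (h01 : ∀ v, u (fun i => f i v) ∈ unitInterval) : 𝓜.Definable fun v => u fun i => f i v := by
  choose φ hφ using hf
  refine ⟨.conn ⟨fun t => Set.projIcc 0 1 zero_le_one (u fun i => t i), by fun_prop⟩ φ, fun v => ?_⟩
  simp only [eval, ContinuousMap.coe_mk, hφ]
  rw [Set.projIcc_of_mem zero_le_one (h01 v)]

theorem comp₁ {f : (Fin n → M) → ℝ} (hf : 𝓜.Definable f) {u : ℝ → ℝ} (hu : Continuous u)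
    (h01 : ∀ v, u (f v) ∈ unitInterval) : 𝓜.Definable fun v => u (f v) :=
  comp (k := 1) (f := fun _ => f) (fun _ => hf) (u := fun t => u (t 0)) (by fun_prop) h01

theorem const {c : ℝ} (hc : c ∈ unitInterval) : 𝓜.Definable fun _ : Fin n → M => c :=
  comp (k := 0) (f := Fin.elim0) (fun i => i.elim0) (u := fun _ => c) continuous_const
    fun _ => hc

theorem max {f g : (Fin n → M) → ℝ} (hf : 𝓜.Definable f) (hg : 𝓜.Definable g) :
    𝓜.Definable fun v => Max.max (f v) (g v) :=
  comp (k := 2) (f := ![f, g]) (fun i => by fin_cases i <;> assumption)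
    (u := fun t => Max.max (t 0) (t 1)) (by fun_prop)
    fun v => ⟨le_max_of_le_left (hf.nonneg v), max_le (hf.le_one v) (hg.le_one v)⟩

theorem rename {m : ℕ} {f : (Fin n → M) → ℝ} (hf : 𝓜.Definable f) (σ : Fin n → Fin m) :
    𝓜.Definable fun v => f (v ∘ σ) := by
  obtain ⟨φ, hφ⟩ := hf
  obtain ⟨ψ, hψ⟩ := 𝓜.exists_eval_comp φ σ
  exact ⟨ψ, fun v => by rw [hψ, hφ]⟩

theorem dist_termVal (t₁ t₂ : S.Term n) :
    𝓜.Definable fun v => dist (𝓜.termVal v t₁) (𝓜.termVal v t₂) :=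
  ⟨.dist t₁ t₂, fun _ => rfl⟩

theorem pred (R : S.Pred) : 𝓜.Definable fun v => (𝓜.pred R v : ℝ) :=
  ⟨.pred R fun i => .var i, fun _ => rfl⟩

theorem dist_comp {k : ℕ} (σ τ : Fin k → Fin n) :
    𝓜.Definable fun v => dist (v ∘ σ) (v ∘ τ) := by
  have h : ∀ v : Fin n → M, dist (v ∘ σ) (v ∘ τ) =
      dist (fun i => dist (v (σ i)) (v (τ i))) 0 := by
    intro v
    simp only [dist_pi_def, Pi.zero_apply, Function.comp]
    congr 2
    funext i
    ext
    simp
  simp only [h]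
  refine comp (fun i => dist_termVal (.var (σ i)) (.var (τ i))) (u := fun t => dist t 0)
    (by fun_prop) fun v => ⟨dist_nonneg, ?_⟩
  refine (dist_pi_le_iff zero_le_one).2 fun i => ?_
  simpa [termVal, abs_of_nonneg] using 𝓜.dist_le_one _ _

theorem iInf_nat {f : ℕ → (Fin n → M) → ℝ} (hf : ∀ k, 𝓜.Definable (f k)) :
    𝓜.Definable fun v => ⨅ k, f k v := by
  choose φ hφ using hf
  exact ⟨.infSeq φ, fun v => by simp only [eval, ← hφ]; exact Set.Icc.coe_iInf zero_le_one⟩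

theorem iSup_nat {f : ℕ → (Fin n → M) → ℝ} (hf : ∀ k, 𝓜.Definable (f k)) :
    𝓜.Definable fun v => ⨆ k, f k v := by
  choose φ hφ using hf
  exact ⟨.supSeq φ, fun v => by simp only [eval, ← hφ]; exact Set.Icc.coe_iSup zero_le_one⟩

variable [Nonempty M]

/-- Nonemptiness of `M` matters: the empty infimum is `1` in `[0, 1]` but `0` in `ℝ`. -/
theorem iInf_snoc {f : (Fin (n + 1) → M) → ℝ} (hf : 𝓜.Definable f) :
    𝓜.Definable fun v => ⨅ a : M, f (Fin.snoc v a) := by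
  obtain ⟨φ, hφ⟩ := hf
  exact ⟨.infVar φ, fun v => by simp only [eval, ← hφ]; exact Set.Icc.coe_iInf zero_le_one⟩

theorem iInf_append {m : ℕ} {f : (Fin (n + m) → M) → ℝ} (hf : 𝓜.Definable f) :
    𝓜.Definable fun v => ⨅ w : Fin m → M, f (Fin.append v w) := by
  induction m with
  | zero =>
    have h : (fun v : Fin n → M => ⨅ w : Fin 0 → M, f (Fin.append v w)) = f := by
      funext v
      rw [ciInf_unique]
      exact congrArg f (Fin.append_right_nil _ _ rfl)
    rw [h]
    exact hf
  | succ m ih =>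
    have := ih (iInf_snoc (n := n + m) hf)
    convert this using 2 with v
    apply le_antisymm
    · refine le_ciInf fun w => le_ciInf fun a => ?_
      rw [← Fin.append_snoc]
      exact ciInf_le (f := fun w : Fin (m + 1) → M => f (Fin.append v w))
        ⟨0, by rintro _ ⟨a, rfl⟩; exact hf.nonneg _⟩ _
    · refine le_ciInf fun w => ?_
      refine (ciInf_le ⟨0, ?_⟩ (Fin.init w)).trans ((ciInf_le ⟨0, ?_⟩ (w (Fin.last m))).trans ?_)
      · rintro _ ⟨w, rfl⟩; exact Real.iInf_nonneg fun a => hf.nonneg _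
      · rintro _ ⟨w, rfl⟩; exact hf.nonneg _
      · rw [← Fin.append_snoc, Fin.snoc_init_self]

end Definable

end MetricStructure

/-! ### The distance between types -/

namespace MetricStructure

variable {S : MetricSignature.{uF, uP, uC}} {M : Type uM} [MetricSpace M]

/-- The largest difference of the values at two tuples of a definable `1`-Lipschitz function. -/
noncomputable def typeDist (𝓜 : MetricStructure S M) {n : ℕ} (a b : Fin n → M) : ℝ :=
  ⨆ f : {f : (Fin n → M) → ℝ // 𝓜.Definable f ∧ LipschitzWith 1 f}, |f.1 a - f.1 b|

variable (𝓜 : MetricStructure S M) {n : ℕ}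

instance : Nonempty {f : (Fin n → M) → ℝ // 𝓜.Definable f ∧ LipschitzWith 1 f} :=
  ⟨⟨_, Definable.const unitInterval.zero_mem, LipschitzWith.const' 0⟩⟩

theorem abs_sub_le_typeDist {f : (Fin n → M) → ℝ} (hf : 𝓜.Definable f)
    (hL : LipschitzWith 1 f) (a b : Fin n → M) : |f a - f b| ≤ 𝓜.typeDist a b := by
  refine le_ciSup (f := fun f : {f : (Fin n → M) → ℝ // 𝓜.Definable f ∧ LipschitzWith 1 f} =>
    |f.1 a - f.1 b|) ⟨dist a b, ?_⟩ ⟨f, hf, hL⟩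
  rintro _ ⟨f, rfl⟩
  simpa [Real.dist_eq] using f.2.2.dist_le_mul a b

theorem typeDist_le_iff {a b : Fin n → M} {r : ℝ} : 𝓜.typeDist a b ≤ r ↔
    ∀ f : (Fin n → M) → ℝ, 𝓜.Definable f → LipschitzWith 1 f → |f a - f b| ≤ r :=
  ⟨fun h _ hf hL => (𝓜.abs_sub_le_typeDist hf hL a b).trans h,
    fun h => ciSup_le fun f => h f.1 f.2.1 f.2.2⟩

theorem typeDist_nonneg (a b : Fin n → M) : 0 ≤ 𝓜.typeDist a b :=
  Real.iSup_nonneg fun _ => abs_nonneg _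

theorem typeDist_comm (a b : Fin n → M) : 𝓜.typeDist a b = 𝓜.typeDist b a := by
  simp only [typeDist, abs_sub_comm]

theorem typeDist_self (a : Fin n → M) : 𝓜.typeDist a a = 0 := by
  simp [typeDist]

theorem typeDist_triangle (a b c : Fin n → M) :
    𝓜.typeDist a c ≤ 𝓜.typeDist a b + 𝓜.typeDist b c :=
  𝓜.typeDist_le_iff.2 fun f hf hL => (abs_sub_le _ (f b) _).trans
    (add_le_add (𝓜.abs_sub_le_typeDist hf hL a b) (𝓜.abs_sub_le_typeDist hf hL b c))

theorem typeDist_le_dist (a b : Fin n → M) : 𝓜.typeDist a b ≤ dist a b :=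
  𝓜.typeDist_le_iff.2 fun f _ hL => by simpa [Real.dist_eq] using hL.dist_le_mul a b

theorem lipschitzWith_typeDist (a : Fin n → M) : LipschitzWith 1 (𝓜.typeDist a) :=
  LipschitzWith.of_le_add fun x y => (𝓜.typeDist_triangle a y x).trans
    (add_le_add_right ((𝓜.typeDist_le_dist y x).trans_eq (dist_comm y x)) _)

theorem typeDist_comp_le {m : ℕ} (σ : Fin m → Fin n) (a b : Fin n → M) :
    𝓜.typeDist (a ∘ σ) (b ∘ σ) ≤ 𝓜.typeDist a b := by
  refine 𝓜.typeDist_le_iff.2 fun f hf hL => 𝓜.abs_sub_le_typeDist (hf.rename σ) ?_ a b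
  refine LipschitzWith.of_le_add fun x y => (hL.le_add_dist _ _).trans (add_le_add_right ?_ _)
  exact (dist_pi_le_iff dist_nonneg).2 fun i => dist_le_pi_dist x y (σ i)

variable [Nonempty M]

/-- A definable property of `a` is nearly satisfied near every tuple whose type is near that of
`a`. -/
theorem exists_dist_lt_of_typeDist_lt {h : (Fin n → M) → ℝ} (hh : 𝓜.Definable h)
    {a b : Fin n → M} (ha : h a = 0) {r δ : ℝ} (hab : 𝓜.typeDist a b < r) (hδ : 0 < δ) :
    ∃ y, dist b y < r ∧ h y < δ := by
  have hd1 : ∀ x y : Fin n → M, dist x y ≤ 1 := fun x y =>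
    (dist_pi_le_iff zero_le_one).2 fun i => 𝓜.dist_le_one _ _
  rcases lt_or_ge 1 r with hr | hr
  · exact ⟨a, (hd1 b a).trans_lt hr, ha ▸ hδ⟩
  have hmem : ∀ y, min 1 (h y / δ) ∈ unitInterval := fun y =>
    ⟨le_min zero_le_one (div_nonneg (hh.nonneg y) hδ.le), min_le_left _ _⟩
  -- The test function is the infimum over `y` of this maximum, with `x` in the first block of
  -- variables. It vanishes at `a`, so it is below `r` at `b`; since `r ≤ 1`, the truncation at `1`
  -- loses nothing.
  have hp : 𝓜.Definable fun v : Fin (n + n) → M =>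
      max (dist (v ∘ Fin.castAdd n) (v ∘ Fin.natAdd n)) (min 1 (h (v ∘ Fin.natAdd n) / δ)) :=
    (Definable.dist_comp _ _).max ((hh.rename _).comp₁ (u := fun t => min 1 (t / δ))
      (by fun_prop) fun v => hmem _)
  have hD := hp.iInf_append
  have hc1 : ∀ x y : Fin n → M, Fin.append x y ∘ Fin.castAdd n = x := fun x y => by
    funext i; simp
  have hc2 : ∀ x y : Fin n → M, Fin.append x y ∘ Fin.natAdd n = y := fun x y => by
    funext i; exact Fin.append_right x y i
  simp only [hc1, hc2] at hD
  have hb : ∀ x, BddBelow (Set.range fun y => max (dist x y) (min 1 (h y / δ))) := fun x =>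
    ⟨0, by rintro _ ⟨y, rfl⟩; exact le_max_of_le_left dist_nonneg⟩
  have hL : LipschitzWith 1 fun x : Fin n → M => ⨅ y, max (dist x y) (min 1 (h y / δ)) := by
    refine LipschitzWith.ciInf hb fun y => LipschitzWith.of_le_add fun x x' => ?_
    refine max_le ?_ ?_
    · rw [add_comm]
      exact (dist_triangle _ x' _).trans (add_le_add_right (le_max_left _ _) _)
    · exact (le_max_right _ _).trans (le_add_of_nonneg_right dist_nonneg)
  have h1 := (le_abs_self _).trans (𝓜.abs_sub_le_typeDist hD hL b a)
  have h2 := ciInf_le (hb a) a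
  simp only [dist_self, ha, zero_div, min_eq_right zero_le_one, max_self] at h2
  rw [typeDist_comm] at h1
  have h3 : ⨅ y, max (dist b y) (min 1 (h y / δ)) < r := by linarith
  obtain ⟨y, hy⟩ := exists_lt_of_ciInf_lt h3
  obtain ⟨hy1, hy2⟩ := max_lt_iff.1 hy
  refine ⟨y, hy1, ?_⟩
  rcases min_lt_iff.1 hy2 with hy2 | hy2
  · exact absurd hy2 hr.not_gt
  · rw [div_lt_iff₀ hδ] at hy2
    exact hy2.trans_le (mul_le_of_le_one_left hδ.le hr)

variable [TopologicalSpace.SeparableSpace M]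

/-- For each member of a dense sequence and each precision, one nearly optimal test function
suffices: the resulting countable supremum is `1`-Lipschitz and agrees with `typeDist a` on a dense
set. The formula depends on `a`, but does not mention it as a parameter. -/
theorem definable_typeDist (a : Fin n → M) : 𝓜.Definable (𝓜.typeDist a) := by
  have h : ∀ p : ℕ × ℕ, ∃ f : (Fin n → M) → ℝ, (𝓜.Definable f ∧ LipschitzWith 1 f) ∧
      𝓜.typeDist a (TopologicalSpace.denseSeq (Fin n → M) p.1) - 1 / (p.2 + 1 : ℝ) <
        |f a - f (TopologicalSpace.denseSeq (Fin n → M) p.1)| := by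
    intro p
    obtain ⟨f, hf⟩ := exists_lt_of_lt_ciSup (sub_lt_self (𝓜.typeDist a
      (TopologicalSpace.denseSeq (Fin n → M) p.1)) (Nat.one_div_pos_of_nat (α := ℝ) (n := p.2)))
    exact ⟨f.1, f.2, hf⟩
  choose f hf hlt using h
  let g : ℕ → (Fin n → M) → ℝ := fun k v => |f k.unpair a - f k.unpair v|
  have hle : ∀ k v, g k v ≤ 𝓜.typeDist a v := fun k v =>
    𝓜.abs_sub_le_typeDist (hf _).1 (hf _).2 a v
  have hbdd : ∀ v, BddAbove (Set.range fun k => g k v) := fun v =>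
    ⟨𝓜.typeDist a v, by rintro _ ⟨k, rfl⟩; exact hle k v⟩
  have hgL : ∀ k, LipschitzWith 1 (g k) := fun k => LipschitzWith.of_le_add fun x y => by
    have h1 := abs_sub_le (f k.unpair a) (f k.unpair y) (f k.unpair x)
    have h2 := (hf k.unpair).2.dist_le_mul y x
    rw [Real.dist_eq, NNReal.coe_one, one_mul, dist_comm] at h2
    exact h1.trans (add_le_add_right h2 _)
  have hgD : ∀ k, 𝓜.Definable (g k) := fun k =>
    (hf k.unpair).1.comp₁ (u := fun t => |f k.unpair a - t|) (by fun_prop) fun v => by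
      have := (hf k.unpair).1
      refine ⟨abs_nonneg _, abs_le.2 ⟨?_, ?_⟩⟩ <;>
      linarith [this.nonneg a, this.le_one a, this.nonneg v, this.le_one v]
  have heq : (fun v => ⨆ k, g k v) = 𝓜.typeDist a := by
    refine Continuous.ext_on (TopologicalSpace.denseRange_denseSeq (Fin n → M))
      (LipschitzWith.ciSup hbdd hgL).continuous (𝓜.lipschitzWith_typeDist a).continuous ?_
    rintro _ ⟨i, rfl⟩
    refine le_antisymm (ciSup_le fun k => hle k _) ?_
    refine le_of_forall_pos_le_add fun ε hε => ?_
    obtain ⟨k, hk⟩ := exists_nat_one_div_lt hε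
    have h1 := hlt (i, k)
    have h2 := le_ciSup (hbdd (TopologicalSpace.denseSeq (Fin n → M) i)) (Nat.pair i k)
    simp only [g, Nat.unpair_pair] at h2
    simp only at h1
    linarith
  rw [← heq]
  exact Definable.iSup_nat hgD

/-- Forth: types are extended without increasing their distance. -/
theorem exists_typeDist_snoc_lt {a b : Fin n → M} {r : ℝ} (hab : 𝓜.typeDist a b < r) (c : M) :
    ∃ d : M, 𝓜.typeDist (Fin.snoc a c : Fin (n + 1) → M) (Fin.snoc b d) < r := by
  have hb : ∀ x : Fin n → M, BddBelow (Set.range fun d =>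
      𝓜.typeDist (Fin.snoc a c : Fin (n + 1) → M) (Fin.snoc x d)) := fun x =>
    ⟨0, by rintro _ ⟨y, rfl⟩; exact 𝓜.typeDist_nonneg _ _⟩
  -- The infimum over `d` vanishes at `x = a`, by taking `d = c`, so at `b` it is below `r`.
  have hL := LipschitzWith.ciInf hb fun d => LipschitzWith.of_le_add fun x y =>
    ((𝓜.lipschitzWith_typeDist _).le_add_dist _ (Fin.snoc y d)).trans_eq (by
      rw [Fin.dist_snoc, dist_self, max_eq_left dist_nonneg])
  have h1 := (le_abs_self _).trans
    (𝓜.abs_sub_le_typeDist (𝓜.definable_typeDist _).iInf_snoc hL b a)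
  have h2 := ciInf_le (hb a) c
  rw [typeDist_self] at h2
  rw [typeDist_comm] at h1
  exact exists_lt_of_ciInf_lt (show _ < r by linarith)

/-- One stage of the back-and-forth construction. -/
theorem exists_typeDist_snoc_snoc_lt {a b : Fin n → M} {r δ : ℝ} (hab : 𝓜.typeDist a b < r)
    (hδ : 0 < δ) (c d : M) : ∃ (c' : M) (b' : Fin (n + 1 + 1) → M),
      dist b (fun i => b' i.castSucc.castSucc) < r ∧ dist d (b' (Fin.last (n + 1))) < r ∧
      𝓜.typeDist (Fin.snoc (Fin.snoc a c : Fin (n + 1) → M) c' : Fin (n + 1 + 1) → M) b' < δ := by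
  obtain ⟨d', hd'⟩ := 𝓜.exists_typeDist_snoc_lt hab c
  rw [typeDist_comm] at hd'
  obtain ⟨c', hc'⟩ := 𝓜.exists_typeDist_snoc_lt hd' d
  rw [typeDist_comm] at hc'
  -- Moving the second tuple by less than `r` brings its type within `δ` of the first: the property
  -- used is the type distance to the first tuple itself.
  obtain ⟨b', hb', hlt⟩ := 𝓜.exists_dist_lt_of_typeDist_lt (𝓜.definable_typeDist _)
    (𝓜.typeDist_self _) hc' hδ
  refine ⟨c', b', ?_, ?_, hlt⟩
  · refine ((dist_pi_le_iff dist_nonneg).2 fun i => ?_).trans_lt hb'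
    simpa using dist_le_pi_dist (Fin.snoc (Fin.snoc b d' : Fin (n + 1) → M) d : Fin (n + 1 + 1) → M) b' i.castSucc.castSucc
  · refine lt_of_le_of_lt ?_ hb'
    simpa using dist_le_pi_dist (Fin.snoc (Fin.snoc b d' : Fin (n + 1) → M) d : Fin (n + 1 + 1) → M) b' (Fin.last (n + 1))

end MetricStructure

/-! ### From close types to automorphisms -/

namespace MetricStructure

variable {S : MetricSignature.{uF, uP, uC}} {M : Type uM} [MetricSpace M]
  (𝓜 : MetricStructure S M) {n : ℕ}

/-- Although `typeDist` only tests `1`-Lipschitz functions, it controls every continuous definable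
one: arbitrarily near `b` there are points where `h` is almost `h a`. -/
theorem eq_of_typeDist_eq_zero [Nonempty M] {h : (Fin n → M) → ℝ} (hh : 𝓜.Definable h)
    (hc : Continuous h) {a b : Fin n → M} (hab : 𝓜.typeDist a b = 0) : h a = h b := by
  refine eq_of_abs_sub_eq_zero (le_antisymm (le_of_forall_pos_lt_add fun ε hε => ?_)
    (abs_nonneg _))
  obtain ⟨δ, hδ, hδb⟩ := Metric.continuousAt_iff.1 hc.continuousAt (ε / 2) (half_pos hε)
  have hk : 𝓜.Definable fun x => |h a - h x| :=
    hh.comp₁ (u := fun t => |h a - t|) (by fun_prop) fun v => by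
      refine ⟨abs_nonneg _, abs_le.2 ⟨?_, ?_⟩⟩ <;>
      linarith [hh.nonneg a, hh.le_one a, hh.nonneg v, hh.le_one v]
  obtain ⟨y, hy, hay⟩ := 𝓜.exists_dist_lt_of_typeDist_lt hk (a := a) (b := b) (by simp)
    (hab.trans_lt hδ) (half_pos hε)
  have := hδb (dist_comm b y ▸ hy)
  rw [Real.dist_eq] at this
  linarith [abs_sub_le (h a) (h y) (h b)]

/-- An isometric bijection preserving types is an automorphism. -/
theorem exists_automorphism_of_typeDist_eq_zero [Nonempty M] (Φ : M ≃ᵢ M)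
    (hΦ : ∀ (m : ℕ) (x : Fin m → M), 𝓜.typeDist x (fun i => Φ (x i)) = 0) :
    ∃ Ψ : 𝓜.Automorphism, ∀ x, Ψ x = Φ x := by
  have hfunc : ∀ f : S.Func, Continuous (𝓜.func f) := by
    refine fun f => Metric.continuous_iff.2 fun b ε hε => ?_
    obtain ⟨q, hq0, hq1⟩ := exists_rat_btwn (lt_min hε one_pos)
    have hq : q ∈ Set.Ioo (0 : ℚ) 1 :=
      ⟨by exact_mod_cast hq0, by exact_mod_cast hq1.trans_le (min_le_right _ _)⟩
    refine ⟨(S.funcMod f ⟨q, hq⟩ : ℚ), by exact_mod_cast (S.funcMod f ⟨q, hq⟩).2.1,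
      fun a ha => ?_⟩
    exact (𝓜.func_modulus f ⟨q, hq⟩ a b ha).trans_lt (hq1.trans_le (min_le_left _ _))
  have hpred : ∀ R : S.Pred, Continuous fun v => (𝓜.pred R v : ℝ) := by
    refine fun R => Metric.continuous_iff.2 fun b ε hε => ?_
    obtain ⟨q, hq0, hq1⟩ := exists_rat_btwn (lt_min hε one_pos)
    have hq : q ∈ Set.Ioo (0 : ℚ) 1 :=
      ⟨by exact_mod_cast hq0, by exact_mod_cast hq1.trans_le (min_le_right _ _)⟩
    refine ⟨(S.predMod R ⟨q, hq⟩ : ℚ), by exact_mod_cast (S.predMod R ⟨q, hq⟩).2.1,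
      fun a ha => ?_⟩
    exact (𝓜.pred_modulus R ⟨q, hq⟩ a b ha).trans_lt (hq1.trans_le (min_le_left _ _))
  refine ⟨⟨Φ, fun f a => ?_, fun R a => ?_, fun c => ?_⟩, fun x => rfl⟩
  -- Adjoining `f a` to the tuple turns preservation of `f` into preservation of a zero distance.
  · have h := 𝓜.eq_of_typeDist_eq_zero
      (Definable.dist_termVal (.func f fun i => .var i.castSucc) (.var (Fin.last _)))
      (by simp only [termVal]; have := hfunc f; fun_prop) (hΦ _ (Fin.snoc a (𝓜.func f a)))
    simp only [termVal, Fin.snoc_castSucc, Fin.snoc_last, dist_self] at h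
    exact (dist_eq_zero.1 h.symm).symm
  · exact Subtype.ext (𝓜.eq_of_typeDist_eq_zero (Definable.pred R) (hpred R) (hΦ _ a)).symm
  · have h := 𝓜.eq_of_typeDist_eq_zero
      (Definable.dist_termVal (n := 1) (.const c) (.var 0))
      (by simp only [termVal]; fun_prop) (hΦ _ fun _ => 𝓜.const c)
    simp only [termVal, dist_self] at h
    exact (dist_eq_zero.1 h.symm).symm

variable [Nonempty M] [TopologicalSpace.SeparableSpace M]

/-- A stage of the back-and-forth construction, for the initial segments of two sequences. -/
theorem exists_extend_of_typeDist_lt {N : ℕ} {a b : ℕ → M} {r δ : ℝ}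
    (hab : 𝓜.typeDist (fun i : Fin N => a i) (fun i => b i) < r) (hδ : 0 < δ) (d : M) :
    ∃ a' b' : ℕ → M, 𝓜.typeDist (fun i : Fin (N + 1 + 1) => a' i) (fun i => b' i) < δ ∧
      (∀ i < N, a' i = a i) ∧ a' N = d ∧ (∀ i < N, dist (b i) (b' i) < r) ∧
      dist d (b' (N + 1)) < r := by
  -- The same `d` serves both directions: exactly at place `N` on the left, approximately at place
  -- `N + 1` on the right.
  obtain ⟨c', b', h1, h2, h3⟩ := 𝓜.exists_typeDist_snoc_snoc_lt hab hδ d d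
  refine ⟨fun i => if i < N then a i else if i = N then d else c',
    fun i => if h : i < N + 1 + 1 then b' ⟨i, h⟩ else d, ?_, fun i hi => by simp [hi], by simp,
    fun i hi => ?_, ?_⟩
  · convert h3 using 2
    · funext i
      refine Fin.lastCases ?_ (fun i => Fin.lastCases ?_ (fun i => ?_) i) i <;> simp
    · funext i
      exact dif_pos i.2
  · simp only [show i < N + 1 + 1 by omega, dif_pos]
    exact (dist_le_pi_dist _ _ (⟨i, hi⟩ : Fin N)).trans_lt h1
  · simp only [show N + 1 < N + 1 + 1 by omega, dif_pos]
    exact h2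

/-- The sequences produced by the back-and-forth construction. -/
theorem exists_backAndForth {a b : Fin n → M} {r : ℝ} (hab : 𝓜.typeDist a b < r) (s : ℕ → M) :
    ∃ u v : ℕ → ℕ → M, (∀ i : Fin n, u 0 i = a i) ∧ (∀ i : Fin n, v 0 i = b i) ∧ ∀ k,
      𝓜.typeDist (fun i : Fin (n + 2 * k) => u k i) (fun i => v k i) < r / 2 ^ k ∧
      (∀ i < n + 2 * k, u (k + 1) i = u k i) ∧ u (k + 1) (n + 2 * k) = s k ∧
      (∀ i < n + 2 * k, dist (v k i) (v (k + 1) i) < r / 2 ^ k) ∧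
      dist (s k) (v (k + 1) (n + 2 * k + 1)) < r / 2 ^ k := by
  have hr : 0 < r := (𝓜.typeDist_nonneg a b).trans_lt hab
  let St : ℕ → Type _ := fun k => {p : (ℕ → M) × (ℕ → M) //
    𝓜.typeDist (fun i : Fin (n + 2 * k) => p.1 i) (fun i => p.2 i) < r / 2 ^ k}
  have step : ∀ k (p : St k), ∃ q : St (k + 1), (∀ i < n + 2 * k, q.1.1 i = p.1.1 i) ∧
      q.1.1 (n + 2 * k) = s k ∧ (∀ i < n + 2 * k, dist (p.1.2 i) (q.1.2 i) < r / 2 ^ k) ∧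
      dist (s k) (q.1.2 (n + 2 * k + 1)) < r / 2 ^ k := by
    intro k p
    obtain ⟨a', b', h, h'⟩ := 𝓜.exists_extend_of_typeDist_lt p.2
      (show 0 < r / 2 ^ (k + 1) by positivity) (s k)
    exact ⟨⟨(a', b'), h⟩, h'⟩
  choose next hnext using step
  have hext : ∀ (x : Fin n → M) (i : Fin n),
      (fun j : ℕ => if h : j < n then x ⟨j, h⟩ else s 0) i = x i := fun x i => by simp
  let p₀ : St 0 := ⟨(fun j => if h : j < n then a ⟨j, h⟩ else s 0,
    fun j => if h : j < n then b ⟨j, h⟩ else s 0), by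
      rw [pow_zero, div_one]
      refine lt_of_eq_of_lt ?_ hab
      exact congrArg₂ _ (funext (hext a)) (funext (hext b))⟩
  let p : ∀ k, St k := fun k => Nat.rec p₀ next k
  exact ⟨fun k => (p k).1.1, fun k => (p k).1.2, hext a, hext b,
    fun k => ⟨(p k).2, hnext k (p k)⟩⟩

/-- Two tuples whose types are close are nearly conjugate under an automorphism. -/
theorem exists_automorphism_dist_le [CompleteSpace M] {a b : Fin n → M} {r : ℝ}
    (hab : 𝓜.typeDist a b < r) :
    ∃ Φ : 𝓜.Automorphism, dist (fun i => Φ (a i)) b ≤ 2 * r := by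
  have hr : 0 < r := (𝓜.typeDist_nonneg a b).trans_lt hab
  let s : ℕ → M := TopologicalSpace.denseSeq M
  -- Unpairing makes each dense point recur at arbitrarily late stages, where the errors are small;
  -- density of `β` needs this.
  obtain ⟨u, v, hu0, hv0, huv⟩ := 𝓜.exists_backAndForth hab fun k => s k.unpair.1
  have hu : ∀ k j i, i < n + 2 * k → u (k + j) i = u k i := by
    intro k j i hi
    induction j with
    | zero => rfl
    | succ j ih => rw [← add_assoc, (huv (k + j)).2.1 i (by omega), ih]
  -- Left entries never change once placed, and place `i` is filled by stage `i + 1`.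
  let α : ℕ → M := fun i => u i.succ i
  have hα : ∀ k i, i < n + 2 * k → u k i = α i := fun k i hi => by
    rw [← hu k i.succ i hi, add_comm k, hu i.succ k i (by omega)]
  have hv : ∀ k i, i < n + 2 * k → ∀ j,
      dist (v (k + j) i) (v (k + j + 1) i) ≤ 2 * r / 2 ^ k / 2 / 2 ^ j := fun k i hi j => by
    refine ((huv (k + j)).2.2.2.1 i (by omega)).le.trans_eq ?_
    rw [pow_add]
    field_simp
  have hex : ∀ i, ∃ y, Tendsto (fun k => v k i) atTop (𝓝 y) := fun i => by
    obtain ⟨y, hy⟩ := cauchySeq_tendsto_of_complete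
      (cauchySeq_of_le_geometric_two (hv (i + 1) i (by omega)))
    refine ⟨y, (tendsto_add_atTop_iff_nat (i + 1)).1 ?_⟩
    simpa only [add_comm] using hy
  choose β hβ using hex
  have hvβ : ∀ k i, i < n + 2 * k → dist (v k i) (β i) ≤ 2 * r / 2 ^ k := fun k i hi => by
    refine dist_le_of_le_geometric_two_of_tendsto₀ (f := fun j => v (k + j) i) (hv k i hi) ?_
    simpa only [add_comm] using (tendsto_add_atTop_iff_nat k).2 (hβ i)
  have hlim : ∀ c : ℝ, Tendsto (fun k : ℕ => c / 2 ^ k) atTop (𝓝 0) := fun c =>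
    tendsto_const_nhds.div_atTop (tendsto_pow_atTop_atTop_of_one_lt one_lt_two)
  have hαβ : ∀ (m : ℕ) (σ : Fin m → ℕ),
      𝓜.typeDist (fun i => α (σ i)) (fun i => β (σ i)) = 0 := by
    intro m σ
    refine le_antisymm (ge_of_tendsto (hlim (3 * r)) ?_) (𝓜.typeDist_nonneg _ _)
    -- The sum bounds every `σ i`, so by stage `k` all these places are filled.
    filter_upwards [eventually_ge_atTop (∑ i, σ i + 1)] with k hk
    have hσ : ∀ i, σ i < n + 2 * k := fun i => by
      have := Finset.single_le_sum (f := σ) (fun _ _ => Nat.zero_le _) (Finset.mem_univ i)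
      omega
    have h1 : 𝓜.typeDist (fun i => α (σ i)) (fun i => v k (σ i)) ≤ r / 2 ^ k := by
      refine le_trans (le_of_eq ?_) ((𝓜.typeDist_comp_le
        (fun i => (⟨σ i, hσ i⟩ : Fin (n + 2 * k))) _ _).trans (huv k).1.le)
      exact congrArg₂ _ (funext fun i => (hα k _ (hσ i)).symm) rfl
    have h2 : dist (fun i => v k (σ i)) (fun i => β (σ i)) ≤ 2 * r / 2 ^ k :=
      (dist_pi_le_iff (by positivity)).2 fun i => hvβ k _ (hσ i)
    calc _ ≤ r / 2 ^ k + 2 * r / 2 ^ k := (𝓜.typeDist_triangle _ _ _).trans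
          (add_le_add h1 ((𝓜.typeDist_le_dist _ _).trans h2))
      _ = 3 * r / 2 ^ k := by ring
  have hαd : DenseRange α := by
    refine (TopologicalSpace.denseRange_denseSeq M).mono ?_
    rintro _ ⟨i, rfl⟩
    refine ⟨n + 2 * Nat.pair i 0, ?_⟩
    rw [← hα (Nat.pair i 0 + 1) _ (by omega), (huv _).2.2.1, Nat.unpair_pair]
  have hβd : DenseRange β := by
    refine Metric.denseRange_iff.2 fun x ε hε => ?_
    obtain ⟨i, hi⟩ := (TopologicalSpace.denseRange_denseSeq M).exists_dist_lt x (half_pos hε)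
    obtain ⟨K, hK⟩ := eventually_atTop.1 ((hlim (2 * r)).eventually_lt_const (half_pos hε))
    have hk := Nat.right_le_pair i K
    have h1 := (huv (Nat.pair i K)).2.2.2.2
    rw [Nat.unpair_pair] at h1
    have h2 := hvβ (Nat.pair i K + 1) (n + 2 * Nat.pair i K + 1) (by omega)
    have h3 := hK _ hk
    have h4 : r / 2 ^ Nat.pair i K + 2 * r / 2 ^ (Nat.pair i K + 1) =
        2 * r / 2 ^ Nat.pair i K := by
      rw [pow_succ]; field_simp; ring
    refine ⟨n + 2 * Nat.pair i K + 1, ?_⟩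
    linarith [dist_triangle4 x (s i) (v (Nat.pair i K + 1) (n + 2 * Nat.pair i K + 1))
      (β (n + 2 * Nat.pair i K + 1))]
  obtain ⟨Φ, hΦ⟩ := exists_isometryEquiv_of_dist_eq hαd hβd fun i j =>
    𝓜.eq_of_typeDist_eq_zero (Definable.dist_termVal (.var 0) (.var 1))
      (by simp only [termVal]; fun_prop) (hαβ 2 ![i, j])
  obtain ⟨Ψ, hΨ⟩ := 𝓜.exists_automorphism_of_typeDist_eq_zero Φ fun m x => by
    refine le_antisymm (le_of_forall_pos_le_add fun ε hε => ?_) (𝓜.typeDist_nonneg _ _)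
    choose σ hσ using fun i => hαd.exists_dist_lt (x i) (half_pos hε)
    have h1 : dist x (fun i => α (σ i)) ≤ ε / 2 :=
      (dist_pi_le_iff (half_pos hε).le).2 fun i => (hσ i).le
    have h2 : dist (fun i => β (σ i)) (fun i => Φ (x i)) ≤ ε / 2 :=
      (dist_pi_le_iff (half_pos hε).le).2 fun i => by
        rw [← hΦ, Φ.dist_eq, dist_comm]; exact (hσ i).le
    have h3 := 𝓜.typeDist_triangle x (fun i => α (σ i)) (fun i => Φ (x i))
    have h4 := 𝓜.typeDist_triangle (fun i => α (σ i)) (fun i => β (σ i)) (fun i => Φ (x i))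
    linarith [𝓜.typeDist_le_dist x (fun i => α (σ i)), hαβ m σ,
      𝓜.typeDist_le_dist (fun i => β (σ i)) (fun i => Φ (x i))]
  refine ⟨Ψ, (dist_pi_le_iff (by positivity)).2 fun i => ?_⟩
  have h := hvβ 0 i (by omega)
  rw [pow_zero, div_one, hv0, dist_comm] at h
  rwa [hΨ, ← hu0, hα 0 i (by omega), hΦ]

end MetricStructure

/-! ### Definability of invariant functions -/

namespace MetricStructure

variable {S : MetricSignature.{uF, uP, uC}} {M : Type uM} [MetricSpace M]

/-- A continuous function invariant under all automorphisms of a separable complete structure is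
definable. -/
theorem definable_of_invariant [CompleteSpace M] [TopologicalSpace.SeparableSpace M]
    (𝓜 : MetricStructure S M) {n : ℕ} {P : (Fin n → M) → unitInterval} (hP : Continuous P)
    (hinv : ∀ (Φ : 𝓜.Automorphism) (a : Fin n → M), P a = P fun i => Φ (a i)) :
    𝓜.Definable fun v => (P v : ℝ) := by
  rcases isEmpty_or_nonempty M with hM | hM
  · have hsub : Subsingleton (Fin n → M) := inferInstance
    rcases isEmpty_or_nonempty (Fin n → M) with he | ⟨⟨v₀⟩⟩
    · obtain ⟨φ, -⟩ := Definable.const (𝓜 := 𝓜) (n := n) unitInterval.zero_mem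
      exact ⟨φ, fun v => he.elim v⟩
    · obtain ⟨φ, hφ⟩ := Definable.const (𝓜 := 𝓜) (n := n) (P v₀).2
      exact ⟨φ, fun v => by rw [hφ, Subsingleton.elim v v₀]⟩
  let D : ℕ → Fin n → M := TopologicalSpace.denseSeq (Fin n → M)
  -- Lipschitz regularization of `P` with respect to `typeDist`: `N` is the penalty for a type
  -- differing from that of `v`.
  let F : ℕ → ℕ → (Fin n → M) → ℝ := fun N i v =>
    min 1 ((P (D i) : ℝ) + N * 𝓜.typeDist (D i) v)
  have hF0 : ∀ N i v, 0 ≤ F N i v := fun N i v => le_min zero_le_one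
    (add_nonneg (P (D i)).2.1 (mul_nonneg N.cast_nonneg (𝓜.typeDist_nonneg _ _)))
  have hF : ∀ N i, 𝓜.Definable (F N i) := fun N i =>
    (𝓜.definable_typeDist (D i)).comp₁ (u := fun t => min 1 ((P (D i) : ℝ) + N * t))
      (by fun_prop) fun v => ⟨hF0 N i v, min_le_left _ _⟩
  have hdef := Definable.iSup_nat fun N => Definable.iInf_nat (hF N)
  have hbelow : ∀ N v, BddBelow (Set.range fun i => F N i v) := fun N v =>
    ⟨0, by rintro _ ⟨i, rfl⟩; exact hF0 N i v⟩
  have hPc : Continuous fun v => (P v : ℝ) := continuous_subtype_val.comp hP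
  have hle : ∀ N v, ⨅ i, F N i v ≤ P v := fun N v => by
    refine le_of_forall_pos_lt_add fun ε hε => ?_
    have hc : ContinuousAt (fun w => (P w : ℝ) + N * dist w v) v := by fun_prop
    have hlt : (P v : ℝ) + N * dist v v < P v + ε := by simpa using hε
    obtain ⟨_, ⟨i, rfl⟩, hw⟩ := (TopologicalSpace.denseRange_denseSeq (Fin n → M)).inter_nhds_nonempty
      (hc.eventually_lt_const hlt)
    refine (ciInf_le (hbelow N v) i).trans_lt ((min_le_right _ _).trans_lt (lt_of_le_of_lt ?_ hw))
    exact add_le_add_right (mul_le_mul_of_nonneg_left (𝓜.typeDist_le_dist _ _) N.cast_nonneg) _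
  have heq : ∀ v, ⨆ N, ⨅ i, F N i v = P v := fun v => by
    refine le_antisymm (ciSup_le fun N => hle N v) (le_of_forall_pos_le_add fun ε hε => ?_)
    obtain ⟨δ, hδ, hδv⟩ := Metric.continuousAt_iff.1 hPc.continuousAt ε hε
    obtain ⟨N, hN⟩ := exists_nat_gt (3 / δ)
    rw [← sub_le_iff_le_add]
    refine le_trans (le_ciInf fun i => le_min ?_ ?_)
      (le_ciSup (f := fun N => ⨅ i, F N i v) ⟨P v, by rintro _ ⟨N, rfl⟩; exact hle N v⟩ N)
    · linarith [(P v).2.2]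
    -- Near types are conjugate up to `2 * (δ / 3) < δ`, so invariance and continuity apply; far
    -- types incur a penalty of at least `1`, as `N > 3 / δ`.
    rcases lt_or_ge (𝓜.typeDist (D i) v) (δ / 3) with hd | hd
    · obtain ⟨Φ, hΦ⟩ := 𝓜.exists_automorphism_dist_le hd
      have h1 := hδv (hΦ.trans_lt (by linarith))
      rw [← hinv Φ, Real.dist_eq] at h1
      have h2 := mul_nonneg N.cast_nonneg (𝓜.typeDist_nonneg (D i) v) (α := ℝ)
      linarith [neg_abs_le ((P (D i) : ℝ) - P v)]
    · have h1 : (1 : ℝ) ≤ N * 𝓜.typeDist (D i) v := by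
        calc (1 : ℝ) = 3 / δ * (δ / 3) := by field_simp
          _ ≤ _ := mul_le_mul hN.le hd (by positivity) N.cast_nonneg
      linarith [(P v).2.2, (P (D i)).2.1]
  simpa only [heq] using hdef

/-- Automorphisms of the structure with constants for the elements of `A` fix `A`. -/
theorem exists_automorphism_of_withConstants (𝓜 : MetricStructure S M) {A : Set M}
    (Φ : (𝓜.withConstants A).Automorphism) :
    ∃ Ψ : 𝓜.Automorphism, (∀ a ∈ A, Ψ a = a) ∧ ∀ x, Ψ x = Φ x :=
  ⟨⟨Φ.toIsometryEquiv, Φ.map_func, Φ.map_pred, fun c => Φ.map_const (.inl c)⟩,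
    fun a ha => Φ.map_const (.inr ⟨a, ha⟩), fun _ => rfl⟩

/-- An automorphism fixing `A` is an automorphism of the structure with constants for the elements
of `A`. -/
def Automorphism.withConstants {𝓜 : MetricStructure S M} (Φ : 𝓜.Automorphism) {A : Set M}
    (hΦ : ∀ a ∈ A, Φ a = a) : (𝓜.withConstants A).Automorphism where
  toIsometryEquiv := Φ.toIsometryEquiv
  map_func := Φ.map_func
  map_pred := Φ.map_pred
  map_const := by
    rintro (c | a)
    · exact Φ.map_const c
    · exact hΦ a a.2

end MetricStructure

theorem mainTheorem3 {S : MetricSignature.{uF, uP, uC}} (hS : S.IsCountable)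
    {M : Type uM} [MetricSpace M] [CompleteSpace M] [TopologicalSpace.SeparableSpace M]
    (𝓜 : MetricStructure S M) (A : Set M) (n : ℕ)
    (P : (Fin n → M) → unitInterval) (hP : Continuous P) :
    List.TFAE [
      ∃ φ : (S.withConstants A).Formula n, ∀ a : Fin n → M, (𝓜.withConstants A).eval φ a = P a,
      ∀ Φ : 𝓜.Automorphism, (∀ a ∈ A, Φ a = a) →
        ∀ a : Fin n → M, P a = P (fun i => Φ (a i)),
      ∀ Φ : 𝓜.Automorphism, (∀ a ∈ closure A, Φ a = a) →
        ∀ a : Fin n → M, P a = P (fun i => Φ (a i))] := by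
  tfae_have 1 → 2 := by
    rintro ⟨φ, hφ⟩ Φ hΦ a
    rw [← hφ, ← hφ]
    exact ((Φ.withConstants hΦ).eval_map φ a).symm
  tfae_have 2 → 3 := fun h Φ hΦ => h Φ fun a ha => hΦ a (subset_closure ha)
  tfae_have 3 → 1 := by
    intro h
    obtain ⟨φ, hφ⟩ := (𝓜.withConstants A).definable_of_invariant hP fun Φ a => by
      obtain ⟨Ψ, hΨA, hΨ⟩ := 𝓜.exists_automorphism_of_withConstants Φ
      have hcl : closure A ⊆ {x | Ψ x = x} := closure_minimal hΨA
        (isClosed_eq Ψ.toIsometryEquiv.continuous continuous_id)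
      simpa only [hΨ] using h Ψ hcl a
    exact ⟨φ, fun a => Subtype.ext (hφ a)⟩
  tfae_finish
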